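/- Let $M=(E,\mathcal I)$ be a matroid on a finite ground set $E$ with rank function $r$ and with $r(E)\ge 2$, and let $t\ge 1$ be an integer. Given a colouring of $E$, a \emph{rainbow basis} is a basis of $M$ whose elements receive pairwise different colours. The \emph{anti-Ramsey number} $ar(M,t)$ is the maximum integer $m$ for which there is a colouring of $E$ using exactly $m$ colours that has no $t$ pairwise disjoint rainbow bases (this maximum exists). If there is a flat $F$ of $M$ with $|E|-|F|<t\,(r(E)-r(F))$, then $ar(M,t)=|E|$. Otherwise $$ar(M,t)=\max_{F}\ \{\,|F|+t\,(r(E)-r(F)-1)\,\},$$ where the maximum is taken over all flats $F$ of $M$ with $r(F)\le r(E)-2$. -/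

import Mathlib

namespace AntiRamsey

/-- The rank `r_M(S)` of a set in a finite matroid, as a natural number
(Mathlib's rank function takes values in `ℕ∞`; it is finite on finite matroids). -/
noncomputable def rk {α : Type*} (M : Matroid α) (S : Set α) : ℕ :=
  (M.eRk S).toNat

/-- A rainbow basis: a basis on which the colouring `c` is injective. -/
def IsRainbowBase {α : Type*} (M : Matroid α) (c : α → ℕ) (B : Set α) : Prop :=
  M.IsBase B ∧ Set.InjOn c B

/-- There are `t` pairwise disjoint rainbow bases. -/
def HasDisjointRainbowBases {α : Type*} (M : Matroid α) (c : α → ℕ) (t : ℕ) : Prop :=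
  ∃ B : Fin t → Set α, (∀ i, IsRainbowBase M c (B i)) ∧ ∀ i j, i ≠ j → Disjoint (B i) (B j)

/-- The numbers `m` such that some colouring of the ground set using exactly `m` colours has no
`t` pairwise disjoint rainbow bases. Colours are natural numbers, which is enough for a finite
ground set; only the values of `c` on the ground set matter. -/
def colorCounts {α : Type*} (M : Matroid α) (t : ℕ) : Set ℕ :=
  {m | ∃ c : α → ℕ, (c '' M.E).ncard = m ∧ ¬ HasDisjointRainbowBases M c t}

/-- The anti-Ramsey number `ar(M, t)`. -/
noncomputable def ar {α : Type*} (M : Matroid α) (t : ℕ) : ℕ :=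
  sSup (colorCounts M t)

end AntiRamsey

/-!
The anti-Ramsey number of `t` disjoint bases of a matroid `M` of rank `r`.

For the lower bound, if some flat `F` has `|E| - |F| < t * (r - r(F))`, then there are no `t`
disjoint bases at all and all elements may receive distinct colours
(`ncard_ground_mem_colorCounts`). Otherwise, for a flat `F` of corank at least two, give distinct
colours to the elements of `F` and to `t * (r - r(F) - 1) - 1` further elements, and one more colour
to everything else. A rainbow basis has at most `r(F)` elements in `F` and at most one element of
the last colour, so it uses at least `r - r(F) - 1` of the further elements, which are too few for
`t` disjoint bases (`mem_colorCounts_of_flat`).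

For the upper bound, suppose that there are more colours than the formula allows. Choose one
element of each colour so that the chosen set `R` spans `M`; an exchange along a hyperplane shows
that this is possible (`exists_spanning_representatives`). By the rank formula for the union of `t`
copies of `M` (`IsPolymatroidRank.exists_sparse_superset`), `R` contains more than `t * (r - 1)`
elements that are independent in this union, since the bound on the number of colours excludes flats
of corank at least two as obstructions, and spanning excludes hyperplanes. They extend to a disjoint
union `J` of `t` bases of `M`, and fewer than `t` elements of `J` exceed the number of colours of
`J`.

Such a `J` can be split into rainbow bases (`exists_rainbow_bases_of_sparse`). The point is that any
`t` elements of `J` can be put into different bases of a splitting (`exists_bases_separating`),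
which follows from Edmonds' matroid partition theorem (`exists_partition_of_sparse`) applied to
contractions of `M`. Since there are fewer than `t` superfluous elements, they can be separated from
one another and, for one of them, from the representative of its colour. The basis containing this
element is then rainbow, and induction on `t` finishes the proof.
-/

namespace AntiRamsey

/-- A finite set function that is normalised, monotone and submodular: the rank function of an
integral polymatroid. -/
structure IsPolymatroidRank {α : Type*} [DecidableEq α] (f : Finset α → ℕ) : Prop where
  empty : f ∅ = 0
  mono : ∀ ⦃X Y : Finset α⦄, X ⊆ Y → f X ≤ f Y
  submod : ∀ X Y : Finset α, f (X ∪ Y) + f (X ∩ Y) ≤ f X + f Y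

/-- A finite set is sparse for `f` if each of its subsets `X` has at most `f X` elements. For a
polymatroid rank function, these are the independent sets of a matroid. -/
def Sparse {α : Type*} (f : Finset α → ℕ) (U : Finset α) : Prop :=
  ∀ X ⊆ U, X.card ≤ f X

/-! ### Sparse sets of a polymatroid and matroid partition -/

section Polymatroid

variable {α : Type*} [DecidableEq α]

/-- The hard half of the rank formula for the matroid of sparse sets, with a prescribed sparse
subset: some sparse `U` between `U₀` and `V` has at least `|V \ Z| + f Z` elements for some `Z`. -/
lemma IsPolymatroidRank.exists_sparse_superset {f : Finset α → ℕ} (hf : IsPolymatroidRank f)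
    {U₀ V : Finset α} (h₀ : U₀ ⊆ V) (hs : Sparse f U₀) :
    ∃ U, U₀ ⊆ U ∧ U ⊆ V ∧ Sparse f U ∧ ∃ Z ⊆ V, (V \ Z).card + f Z ≤ U.card := by
  classical
  obtain ⟨U, hU, hmax⟩ := (V.powerset.filter fun U => U₀ ⊆ U ∧ Sparse f U).exists_max_image
    Finset.card ⟨U₀, by simp [h₀, hs]⟩
  simp only [Finset.mem_filter, Finset.mem_powerset] at hU hmax
  obtain ⟨hUV, hU₀, hUs⟩ := hU
  refine ⟨U, hU₀, hUV, hUs, ?_⟩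
  obtain ⟨Z, hZ, hZmax⟩ := (V.powerset.filter fun Z => f Z ≤ (Z ∩ U).card).exists_max_image
    Finset.card ⟨∅, by simp [hf.empty]⟩
  simp only [Finset.mem_filter, Finset.mem_powerset] at hZ hZmax
  obtain ⟨hZV, hZf⟩ := hZ
  refine ⟨Z, hZV, ?_⟩
  -- The sets `X` with `f X ≤ |X ∩ U|` are closed under unions, so `Z` is the largest of them.
  have hlarge : ∀ X ⊆ V, f X ≤ (X ∩ U).card → X ⊆ Z := by
    intro X hXV hX
    have h1 := hf.submod X Z
    have h2 := hUs (X ∩ Z ∩ U) Finset.inter_subset_right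
    have h3 : f (X ∩ Z ∩ U) ≤ f (X ∩ Z) := hf.mono Finset.inter_subset_left
    have h4 := Finset.card_union_add_card_inter (X ∩ U) (Z ∩ U)
    rw [← Finset.union_inter_distrib_right, ← Finset.inter_inter_distrib_right] at h4
    have h5 := hZmax (X ∪ Z) ⟨Finset.union_subset hXV hZV, by omega⟩
    rw [Finset.eq_of_subset_of_card_le Finset.subset_union_right h5]
    exact Finset.subset_union_left
  have hsub : V \ Z ⊆ U \ Z := by
    intro e he
    rw [Finset.mem_sdiff] at he ⊢
    refine ⟨?_, he.2⟩
    by_contra heU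
    -- Otherwise `insert e U` is not sparse, and a violating set contains `e` and lies in `Z`.
    have hns : ¬ Sparse f (insert e U) := by
      intro h
      have := hmax (insert e U) ⟨Finset.insert_subset he.1 hUV,
        hU₀.trans (Finset.subset_insert _ _), h⟩
      rw [Finset.card_insert_of_notMem heU] at this
      omega
    simp only [Sparse, not_forall, not_le] at hns
    obtain ⟨X, hX, hXc⟩ := hns
    have heX : e ∈ X := by
      by_contra h
      exact absurd (hUs X ((Finset.subset_insert_iff_of_notMem h).1 hX)) (by omega)
    have hXU : X.erase e ⊆ X ∩ U := by
      intro x hx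
      have h1 := Finset.mem_of_mem_erase hx
      have h2 := Finset.mem_insert.1 (hX h1)
      exact Finset.mem_inter.2 ⟨h1, h2.resolve_left (Finset.ne_of_mem_erase hx)⟩
    have := Finset.card_le_card hXU
    rw [Finset.card_erase_of_mem heX] at this
    exact he.2 (hlarge X (hX.trans (Finset.insert_subset he.1 hUV)) (by omega) heX)
  have h1 := Finset.card_le_card hsub
  have h2 := Finset.card_sdiff_add_card_inter U Z
  rw [Finset.inter_comm] at h2
  omega

/-- Edmonds' matroid partition theorem, for rank functions: a set `U` splits into independent sets
`P i` of the given matroids as soon as `|X| ≤ ∑ i, r i X` for all `X ⊆ U`. As in Rado's proof of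
Hall's theorem, the pairs `(e, i)` meaning that `e` may go into `P i` are thinned out until each
element has one place left. -/
theorem exists_partition_of_sparse {ι : Type*} [Fintype ι] [DecidableEq ι]
    {r : ι → Finset α → ℕ} (hr : ∀ i, IsPolymatroidRank (r i)) (hr1 : ∀ i X, r i X ≤ X.card)
    {U : Finset α} (hU : Sparse (fun X => ∑ i, r i X) U) :
    ∃ P : ι → Finset α, (∀ i, r i (P i) = (P i).card) ∧
      (∀ i j, i ≠ j → Disjoint (P i) (P j)) ∧ Finset.univ.biUnion P = U := by
  classical
  -- `A` is the set of allowed pairs, and `g A X i` the part of `X` that may go into `P i`.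
  let g : Finset (α × ι) → Finset α → ι → Finset α := fun A X i => X.filter fun e => (e, i) ∈ A
  let good : Finset (α × ι) → Prop := fun A => ∀ X ⊆ U, X.card ≤ ∑ i, r i (g A X i)
  obtain ⟨A, hA, hmin⟩ := ((U ×ˢ (Finset.univ : Finset ι)).powerset.filter good).exists_min_image
    Finset.card ⟨U ×ˢ Finset.univ, by
      simp only [Finset.mem_filter, Finset.mem_powerset, subset_refl, true_and]
      intro X hX
      refine (hU X hX).trans (le_of_eq (Finset.sum_congr rfl fun i _ => ?_))
      congr 1
      symm
      exact Finset.filter_true_of_mem fun e he => by simp [hX he]⟩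
  simp only [Finset.mem_filter, Finset.mem_powerset] at hA hmin
  obtain ⟨hAU, hgood⟩ := hA
  -- Removing an allowed pair from `A` creates a violating set.
  have hviol : ∀ e i, (e, i) ∈ A → ∃ X ⊆ U, ∑ k, r k (g (A.erase (e, i)) X k) < X.card := by
    intro e i h
    by_contra! hcon
    have := hmin (A.erase (e, i)) ⟨(Finset.erase_subset _ _).trans hAU, hcon⟩
    rw [Finset.card_erase_of_mem h] at this
    have := Finset.card_pos.2 ⟨_, h⟩
    omega
  have huniq : ∀ e i j, (e, i) ∈ A → (e, j) ∈ A → i = j := by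
    intro e i j hi hj
    by_contra hij
    obtain ⟨X, hXU, hX⟩ := hviol e i hi
    obtain ⟨Y, hYU, hY⟩ := hviol e j hj
    have hmem : ∀ (Z : Finset α) (k : ι), Z ⊆ U →
        ∑ l, r l (g (A.erase (e, k)) Z l) < Z.card → e ∈ Z := by
      intro Z k hZU hZ
      by_contra heZ
      refine absurd (hgood Z hZU) (not_le.2 (lt_of_le_of_lt (le_of_eq ?_) hZ))
      refine Finset.sum_congr rfl fun l _ => ?_
      congr 1
      refine Finset.filter_congr fun x hx => ?_
      have : x ≠ e := fun h => heZ (h ▸ hx)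
      simp [this]
    have heX := hmem X i hXU hX
    have heY := hmem Y j hYU hY
    have hle : ∑ k, r k (g A (X ∪ Y) k) + ∑ k, r k (g A ((X ∩ Y).erase e) k) ≤
        ∑ k, r k (g (A.erase (e, i)) X k) + ∑ k, r k (g (A.erase (e, j)) Y k) := by
      rw [← Finset.sum_add_distrib, ← Finset.sum_add_distrib]
      refine Finset.sum_le_sum fun k _ => ?_
      refine le_trans (Nat.add_le_add ((hr k).mono ?_) ((hr k).mono ?_))
        ((hr k).submod (g (A.erase (e, i)) X k) (g (A.erase (e, j)) Y k))
      · intro x hx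
        simp only [g, Finset.mem_filter, Finset.mem_union, Finset.mem_erase, ne_eq,
          Prod.mk.injEq, not_and] at hx ⊢
        by_cases hxe : x = e
        · subst hxe
          by_cases hki : k = i
          · exact Or.inr ⟨heY, fun _ h => hij (hki ▸ h), hx.2⟩
          · exact Or.inl ⟨heX, fun _ => hki, hx.2⟩
        · exact hx.1.imp (fun h => ⟨h, fun h' => absurd h' hxe, hx.2⟩)
            (fun h => ⟨h, fun h' => absurd h' hxe, hx.2⟩)
      · intro x hx
        simp only [g, Finset.mem_filter, Finset.mem_inter, Finset.mem_erase, ne_eq,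
          Prod.mk.injEq, not_and] at hx ⊢
        exact ⟨⟨hx.1.2.1, fun h => absurd h hx.1.1, hx.2⟩,
          hx.1.2.2, fun h => absurd h hx.1.1, hx.2⟩
    have h1 := hgood (X ∪ Y) (Finset.union_subset hXU hYU)
    have h2 := hgood ((X ∩ Y).erase e)
      ((Finset.erase_subset _ _).trans (Finset.inter_subset_left.trans hXU))
    rw [Finset.card_erase_of_mem (Finset.mem_inter.2 ⟨heX, heY⟩)] at h2
    have h3 := Finset.card_union_add_card_inter X Y
    omega
  have hdisj : ∀ i j, i ≠ j → Disjoint (g A U i) (g A U j) := by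
    intro i j hij
    rw [Finset.disjoint_left]
    intro x hx hy
    exact hij (huniq x i j (Finset.mem_filter.1 hx).2 (Finset.mem_filter.1 hy).2)
  have hsub : Finset.univ.biUnion (g A U) ⊆ U :=
    Finset.biUnion_subset.2 fun i _ => Finset.filter_subset _ _
  have hcard : (Finset.univ.biUnion (g A U)).card = ∑ i, (g A U i).card :=
    Finset.card_biUnion fun i _ j _ hij => hdisj i j hij
  have h1 := hgood U subset_rfl
  have h2 := Finset.card_le_card hsub
  have h3 : ∑ i, r i (g A U i) ≤ ∑ i, (g A U i).card := Finset.sum_le_sum fun i _ => hr1 i _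
  have h4 : ∑ i, r i (g A U i) = ∑ i, (g A U i).card := by omega
  refine ⟨g A U, fun i => ?_, hdisj, Finset.eq_of_subset_of_card_le hsub (by omega)⟩
  exact (Finset.sum_eq_sum_iff_of_le fun i _ => hr1 i _).1 h4 i (Finset.mem_univ i)

end Polymatroid

/-! ### The rank function as a natural number -/

section Rank

lemma rk_closure {α : Type*} {M : Matroid α} (S : Set α) : rk M (M.closure S) = rk M S := by
  simp [rk]

variable {α : Type*} {M : Matroid α} [M.RankFinite]

lemma coe_rk (S : Set α) : (rk M S : ℕ∞) = M.eRk S :=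
  ENat.natCast_toNat (Matroid.eRk_ne_top_iff.2 (M.isRkFinite_set S))

lemma rk_mono {S T : Set α} (h : S ⊆ T) : rk M S ≤ rk M T := by
  have := M.eRk_mono h
  rw [← coe_rk, ← coe_rk] at this
  exact_mod_cast this

lemma rk_le_rk_ground (S : Set α) : rk M S ≤ rk M M.E := by
  have := M.eRk_le_eRank S
  rw [← M.eRk_ground, ← coe_rk, ← coe_rk] at this
  exact_mod_cast this

lemma rk_le_card (X : Finset α) : rk M X ≤ X.card := by
  have := M.eRk_le_encard X
  rw [← coe_rk, Set.encard_coe_eq_coe_finsetCard] at this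
  exact_mod_cast this

lemma rk_insert_of_notMem_closure {e : α} {S : Set α} (he : e ∈ M.E) (h : e ∉ M.closure S) :
    rk M (insert e S) = rk M S + 1 := by
  have := M.eRk_insert_eq_add_one ⟨he, h⟩
  rw [← coe_rk, ← coe_rk] at this
  exact_mod_cast this

lemma isPolymatroidRank_rk [DecidableEq α] : IsPolymatroidRank fun X : Finset α => rk M X where
  empty := by simp [rk]
  mono X Y h := rk_mono (by exact_mod_cast h)
  submod X Y := by
    have := M.eRk_inter_add_eRk_union_le X Y
    simp only [← coe_rk] at this
    push_cast
    rw [add_comm]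
    exact_mod_cast this

lemma indep_of_card_le_rk {X : Finset α} (h : X.card ≤ rk M X) : M.Indep X := by
  rw [Matroid.indep_iff_eRk_eq_encard_of_finite X.finite_toSet, ← coe_rk,
    Set.encard_coe_eq_coe_finsetCard]
  exact_mod_cast le_antisymm (rk_le_card X) h

lemma isBase_of_card_le_rk {X : Finset α} (h : X.card ≤ rk M X) (h' : rk M M.E ≤ X.card) :
    M.IsBase X := by
  refine (indep_of_card_le_rk h).isBase_of_eRk_ge X.finite_toSet ?_
  rw [← M.eRk_ground, ← coe_rk, ← coe_rk]
  exact_mod_cast h'.trans h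

lemma card_eq_of_isBase {X : Finset α} (h : M.IsBase X) : X.card = rk M M.E := by
  have := h.encard_eq_eRank
  rw [← M.eRk_ground, ← coe_rk, Set.encard_coe_eq_coe_finsetCard] at this
  exact_mod_cast this

lemma card_le_rk_of_indep {X : Finset α} {S : Set α} (h : M.Indep X) (hS : (X : Set α) ⊆ S) :
    X.card ≤ rk M S := by
  have := h.encard_le_eRk_of_subset hS
  rw [← coe_rk, Set.encard_coe_eq_coe_finsetCard] at this
  exact_mod_cast this

end Rank

/-! ### Separating prescribed elements in a base packing -/

section Separation

variable {α : Type*} [DecidableEq α] {M : Matroid α} [M.RankFinite]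

/-- A set covered by `n` independent sets is sparse for `n * rk`. -/
lemma sparse_of_forall_indep {ι : Type*} {s : Finset ι} {B : ι → Finset α} {J : Finset α}
    (hB : ∀ i ∈ s, M.Indep (B i)) (hJ : J ⊆ s.biUnion B) :
    Sparse (fun X => s.card * rk M X) J := by
  intro X hX
  have h1 : X ⊆ s.biUnion fun i => X ∩ B i := by
    intro x hx
    obtain ⟨i, hi, hxi⟩ := Finset.mem_biUnion.1 (hJ (hX hx))
    exact Finset.mem_biUnion.2 ⟨i, hi, Finset.mem_inter.2 ⟨hx, hxi⟩⟩
  refine (Finset.card_le_card h1).trans (Finset.card_biUnion_le.trans ?_)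
  refine Finset.sum_le_card_nsmul s _ _ fun i hi => ?_
  refine card_le_rk_of_indep ((hB i hi).subset ?_) ?_ <;> push_cast
  · exact Set.inter_subset_right
  · exact Set.inter_subset_left

/-- If `J` is the disjoint union of `t` bases, then any `t` elements of `J` can be put into
different bases: `J` also splits into bases `B d`, one for each of the given elements `d`, with
`d ∈ B d`. This is the matroid partition theorem for the contractions of the elements `d`. -/
theorem exists_bases_separating {D J : Finset α} (hJE : (J : Set α) ⊆ M.E)
    (hJ : Sparse (fun X => D.card * rk M X) J) (hcard : J.card = D.card * rk M M.E)
    (hDJ : D ⊆ J) :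
    ∃ B : D → Finset α, (∀ d, M.IsBase (B d)) ∧ (∀ d, (d : α) ∈ B d) ∧
      (∀ d d', d ≠ d' → Disjoint (B d) (B d')) ∧ Finset.univ.biUnion B = J := by
  classical
  have hpos : ∀ (d : D) (X : Finset α), 1 ≤ rk M (insert (d : α) X : Finset α) := by
    intro d X
    have h1 := hJ {(d : α)} (Finset.singleton_subset_iff.2 (hDJ d.2))
    rw [Finset.card_singleton] at h1
    refine (Nat.pos_of_mul_pos_left h1).trans_le (rk_mono ?_)
    simp
  -- The rank function of the contraction of `d`.
  let r : D → Finset α → ℕ := fun d X => rk M (insert (d : α) X : Finset α) - 1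
  have hr : ∀ d, IsPolymatroidRank (r d) := by
    intro d
    refine ⟨?_, fun X Y h => ?_, fun X Y => ?_⟩
    · have := rk_le_card (M := M) (insert (d : α) ∅)
      simp only [insert_empty_eq, Finset.card_singleton] at this
      simp only [r, insert_empty_eq]
      omega
    · exact Nat.sub_le_sub_right (isPolymatroidRank_rk.mono (Finset.insert_subset_insert _ h)) 1
    · have h := isPolymatroidRank_rk (M := M).submod (insert (d : α) X) (insert (d : α) Y)
      rw [← Finset.insert_union_distrib, ← Finset.insert_inter_distrib] at h
      have h1 := hpos d X
      have h2 := hpos d Y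
      have h3 := hpos d (X ∩ Y)
      have h4 := hpos d (X ∪ Y)
      simp only [r]
      omega
  have hr1 : ∀ d X, r d X ≤ X.card := by
    intro d X
    have h1 := rk_le_card (M := M) (insert (d : α) X)
    have h2 := Finset.card_insert_le (d : α) X
    simp only [r]
    omega
  have hsparse : Sparse (fun X => ∑ d, r d X) (J \ D) := by
    intro X hX
    -- Contracting `d` lowers the rank of `X` only if `d` lies in the closure of `X`.
    let K : Finset α := D.filter fun d => d ∈ M.closure X
    have hXJ : X ⊆ J := hX.trans Finset.sdiff_subset
    have hXE : (X : Set α) ⊆ M.E := fun x hx => hJE (hXJ hx)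
    have hdisj : Disjoint X K := Finset.disjoint_left.2 fun x hx hxK =>
      (Finset.mem_sdiff.1 (hX hx)).2 (Finset.mem_filter.1 hxK).1
    have h1 := hJ (X ∪ K) (Finset.union_subset hXJ ((Finset.filter_subset _ _).trans hDJ))
    have h2 : rk M (X ∪ K : Finset α) ≤ rk M X := by
      rw [← rk_closure (M := M) (X : Set α)]
      refine rk_mono ?_
      intro x hx
      rcases Finset.mem_union.1 (Finset.mem_coe.1 hx) with hx | hx
      · exact M.subset_closure X hXE hx
      · exact (Finset.mem_filter.1 hx).2
    rw [Finset.card_union_of_disjoint hdisj] at h1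
    have h3 : K.card = ∑ d : D, if (d : α) ∈ M.closure X then 1 else 0 := by
      rw [Finset.sum_coe_sort D fun d => if d ∈ M.closure X then 1 else 0, Finset.card_filter]
    have h4 : ∑ _d : D, rk M X ≤ ∑ d : D, (r d X + if (d : α) ∈ M.closure X then 1 else 0) := by
      refine Finset.sum_le_sum fun d _ => ?_
      have h5 : rk M X ≤ rk M (insert (d : α) X : Finset α) := rk_mono (by simp)
      split_ifs with h
      · simp only [r]
        omega
      · have h6 := rk_insert_of_notMem_closure (hJE (hDJ d.2)) h
        simp only [r]
        push_cast
        omega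
    rw [Finset.sum_add_distrib, ← h3, Finset.sum_const, Finset.card_univ, Fintype.card_coe,
      smul_eq_mul] at h4
    have h5 := Nat.mul_le_mul_left D.card h2
    simp only at h1 ⊢
    omega
  obtain ⟨P, hP, hPd, hPU⟩ := exists_partition_of_sparse hr hr1 hsparse
  have hPsub : ∀ d, P d ⊆ J \ D := fun d => hPU ▸ Finset.subset_biUnion_of_mem P (Finset.mem_univ d)
  have hPD : ∀ (d d' : D), (d' : α) ∉ P d := fun d d' h =>
    (Finset.mem_sdiff.1 (hPsub d h)).2 d'.2
  have hBcard : ∀ d : D, (insert (d : α) (P d)).card = (P d).card + 1 := fun d =>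
    Finset.card_insert_of_notMem (hPD d d)
  have hBrk : ∀ d : D, (insert (d : α) (P d)).card ≤ rk M (insert (d : α) (P d) : Finset α) := by
    intro d
    have h1 := hP d
    have h2 := hpos d (P d)
    simp only [r] at h1
    rw [hBcard]
    omega
  have hsum : ∑ d : D, (insert (d : α) (P d)).card = ∑ _d : D, rk M M.E := by
    have h1 : (J \ D).card = ∑ d, (P d).card := by
      rw [← hPU]
      exact Finset.card_biUnion fun i _ j _ hij => hPd i j hij
    simp only [hBcard, Finset.sum_add_distrib, Finset.sum_const, Finset.card_univ,
      Fintype.card_coe, smul_eq_mul, mul_one]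
    rw [← h1, Finset.card_sdiff_add_card_eq_card hDJ, hcard]
  have hle : ∀ d : D, (insert (d : α) (P d)).card ≤ rk M M.E := fun d =>
    (hBrk d).trans (rk_le_rk_ground _)
  have heq := (Finset.sum_eq_sum_iff_of_le fun d _ => hle d).1 hsum
  refine ⟨fun d => insert (d : α) (P d), fun d => ?_, fun d => Finset.mem_insert_self _ _, ?_, ?_⟩
  · exact isBase_of_card_le_rk (hBrk d) (heq d (Finset.mem_univ d)).ge
  · intro d d' hdd
    rw [Finset.disjoint_insert_left, Finset.disjoint_insert_right, Finset.mem_insert]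
    exact ⟨fun h => h.elim (fun h => hdd (Subtype.ext h)) (hPD d' d), hPD d d', hPd d d' hdd⟩
  · ext x
    simp only [Finset.mem_biUnion, Finset.mem_univ, true_and, Finset.mem_insert]
    constructor
    · rintro ⟨d, rfl | h⟩
      · exact hDJ d.2
      · exact (Finset.mem_sdiff.1 (hPsub d h)).1
    · intro hx
      by_cases hxD : x ∈ D
      · exact ⟨⟨x, hxD⟩, Or.inl rfl⟩
      · have : x ∈ Finset.univ.biUnion P := by
          rw [hPU]
          exact Finset.mem_sdiff.2 ⟨hx, hxD⟩
        obtain ⟨d, -, h⟩ := Finset.mem_biUnion.1 this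
        exact ⟨d, Or.inr h⟩

end Separation

/-! ### Rainbow base packings -/

section Rainbow

variable {α : Type*} [DecidableEq α] {M : Matroid α} [M.RankFinite]

/-- If a disjoint union `J` of `t` bases has fewer than `t` elements too many to be rainbow, then
it splits into `t` rainbow bases. Let `R` contain one element of each colour of `J`. If a colour
is repeated, then the elements of `J \ R`, together with an element of `R` sharing its colour with
some `s ∈ J \ R`, number at most `t`. Put them into different bases; then the basis containing `s`
is rainbow, and removing it leaves the same situation for `t - 1`. -/
theorem exists_rainbow_bases_of_sparse (c : α → ℕ) (hpos : 1 ≤ rk M M.E) (t : ℕ) (J : Finset α)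
    (hJE : (J : Set α) ⊆ M.E) (hJ : Sparse (fun X => t * rk M X) J)
    (hcard : J.card = t * rk M M.E) (hcol : t * rk M M.E < (J.image c).card + t) :
    ∃ B : Fin t → Finset α, (∀ i, M.IsBase (B i) ∧ Set.InjOn c (B i)) ∧ (∀ i, B i ⊆ J) ∧
      ∀ i j, i ≠ j → Disjoint (B i) (B j) := by
  classical
  induction t generalizing J with
  | zero =>
    have h1 := Finset.card_image_le (s := J) (f := c)
    omega
  | succ t ih =>
    obtain ⟨R, hRJ, hRinj, hRim⟩ :=
      Finset.exists_subset_injOn_image_eq_of_surjOn (f := c) (J : Set α) (J.image c)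
        (by rw [Finset.coe_image]; exact Set.surjOn_image c J)
    rw [Finset.coe_subset] at hRJ
    have hRcard : R.card = (J.image c).card := by rw [← hRim, Finset.card_image_of_injOn hRinj]
    have hDcard := Finset.card_sdiff_add_card_eq_card hRJ
    have hJt : t + 1 ≤ J.card := by rw [hcard]; exact Nat.le_mul_of_pos_right _ hpos
    by_cases hinj : Set.InjOn c J
    · obtain ⟨D, hDJ, hDt⟩ := Finset.exists_subset_card_eq hJt
      rw [← hDt] at hJ hcard
      obtain ⟨B, hB, -, hBd, hBJ⟩ := exists_bases_separating hJE hJ hcard hDJ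
      have hBsub : ∀ d, B d ⊆ J := fun d =>
        hBJ ▸ Finset.subset_biUnion_of_mem B (Finset.mem_univ d)
      let φ : Fin (t + 1) ≃ D := (D.equivFinOfCardEq hDt).symm
      refine ⟨fun i => B (φ i), fun i => ⟨hB _, hinj.mono (hBsub _)⟩, fun i => hBsub _,
        fun i j hij => hBd _ _ (φ.injective.ne hij)⟩
    · obtain ⟨s, hsJ, hsR⟩ : ∃ s ∈ J, s ∉ R := by
        by_contra! h
        exact hinj (hRinj.mono h)
      obtain ⟨e, heR, hes⟩ : ∃ e ∈ R, c e = c s := by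
        have : c s ∈ R.image c := hRim ▸ Finset.mem_image_of_mem c hsJ
        simpa using this
      obtain ⟨D, hDsub, hDJ, hDt⟩ := Finset.exists_subsuperset_card_eq (n := t + 1)
        (Finset.insert_subset (hRJ heR) (Finset.sdiff_subset : J \ R ⊆ J))
        ((Finset.card_insert_le _ _).trans (by omega)) hJt
      have hsD : s ∈ D := hDsub (by simp [hsJ, hsR])
      rw [← hDt] at hJ hcard
      obtain ⟨B, hB, hBmem, hBd, hBJ⟩ := exists_bases_separating hJE hJ hcard hDJ
      rw [hDt] at hJ hcard
      have hBsub : ∀ d, B d ⊆ J := fun d =>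
        hBJ ▸ Finset.subset_biUnion_of_mem B (Finset.mem_univ d)
      set B₀ := B ⟨s, hsD⟩ with hB₀
      have hB₀D : ∀ x ∈ B₀, x ∈ D → x = s := by
        intro x hx hxD
        by_contra hne
        exact Finset.disjoint_left.1 (hBd ⟨x, hxD⟩ ⟨s, hsD⟩ (by simpa using hne)) (hBmem _) hx
      have hB₀R : ∀ x ∈ B₀, x ∉ R → x = s := fun x hx hxR =>
        hB₀D x hx (hDsub (Finset.mem_insert_of_mem (Finset.mem_sdiff.2 ⟨hBsub _ hx, hxR⟩)))
      have heB₀ : e ∉ B₀ := fun h =>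
        hsR (hB₀D e h (hDsub (Finset.mem_insert_self _ _)) ▸ heR)
      have hkey : ∀ x ∈ B₀, x ∈ R → c x ≠ c s := fun x hx hxR h =>
        heB₀ (hRinj hxR heR (h.trans hes.symm) ▸ hx)
      have hB₀inj : Set.InjOn c B₀ := by
        intro x hx y hy hxy
        by_cases hxR : x ∈ R <;> by_cases hyR : y ∈ R
        · exact hRinj hxR hyR hxy
        · exact absurd (hB₀R y hy hyR ▸ hxy) (hkey x hx hxR)
        · exact absurd (hB₀R x hx hxR ▸ hxy.symm) (hkey y hy hyR)
        · rw [hB₀R x hx hxR, hB₀R y hy hyR]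
      have hB₀card : B₀.card = rk M M.E := card_eq_of_isBase (hB _)
      have hJ'card : (J \ B₀).card = t * rk M M.E := by
        have := Finset.card_sdiff_add_card_eq_card (hBsub ⟨s, hsD⟩)
        rw [hcard, ← hB₀, hB₀card, add_one_mul] at this
        omega
      have hJ'sparse : Sparse (fun X => t * rk M X) (J \ B₀) := by
        have h1 : (Finset.univ.erase (⟨s, hsD⟩ : D)).card = t := by
          rw [Finset.card_erase_of_mem (Finset.mem_univ _), Finset.card_univ, Fintype.card_coe,
            hDt, Nat.add_sub_cancel]
        rw [← h1]
        refine sparse_of_forall_indep (B := B) (fun d _ => (hB d).indep) fun x hx => ?_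
        rw [Finset.mem_sdiff, ← hBJ, Finset.mem_biUnion] at hx
        obtain ⟨⟨d, -, hxd⟩, hx0⟩ := hx
        refine Finset.mem_biUnion.2 ⟨d, Finset.mem_erase.2 ⟨?_, Finset.mem_univ d⟩, hxd⟩
        rintro rfl
        exact hx0 hxd
      -- The colour of `s` survives in `e`, so removing `B₀` costs at most `|B₀| - 1` colours.
      have hJ'col : (J.image c).card ≤ ((J \ B₀).image c).card + (B₀.erase s).card := by
        refine (Finset.card_le_card (t := (J \ B₀).image c ∪ (B₀.erase s).image c) ?_).trans
          ((Finset.card_union_le _ _).trans (Nat.add_le_add_left Finset.card_image_le _))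
        intro k hk
        obtain ⟨x, hx, rfl⟩ := Finset.mem_image.1 hk
        rw [Finset.mem_union]
        by_cases hxB : x ∈ B₀
        · by_cases hxs : x = s
          · refine Or.inl (Finset.mem_image.2 ⟨e, Finset.mem_sdiff.2 ⟨hRJ heR, heB₀⟩, ?_⟩)
            rw [hes, hxs]
          · exact Or.inr (Finset.mem_image_of_mem c (Finset.mem_erase.2 ⟨hxs, hxB⟩))
        · exact Or.inl (Finset.mem_image_of_mem c (Finset.mem_sdiff.2 ⟨hx, hxB⟩))
      rw [Finset.card_erase_of_mem (hBmem ⟨s, hsD⟩), ← hB₀, hB₀card] at hJ'col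
      obtain ⟨B', hB', hB'sub, hB'd⟩ := ih (J \ B₀)
        (fun x hx => hJE (Finset.mem_sdiff.1 hx).1) hJ'sparse hJ'card
        (by rw [add_one_mul] at hcol; omega)
      have hdisj : ∀ i, Disjoint B₀ (B' i) := fun i =>
        Finset.disjoint_sdiff.mono_right (hB'sub i)
      refine ⟨Fin.cons B₀ B', fun i => ?_, fun i => ?_, fun i j hij => ?_⟩
      · refine Fin.cases ?_ (fun i => ?_) i
        · exact ⟨hB _, hB₀inj⟩
        · exact hB' i
      · refine Fin.cases ?_ (fun i => ?_) i
        · exact hBsub _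
        · exact (hB'sub i).trans Finset.sdiff_subset
      · induction i using Fin.cases with
        | zero =>
          induction j using Fin.cases with
          | zero => exact absurd rfl hij
          | succ j => exact hdisj j
        | succ i =>
          induction j using Fin.cases with
          | zero => exact (hdisj i).symm
          | succ j => exact hB'd i j fun h => hij (h ▸ rfl)

end Rainbow

/-! ### The upper bound -/

section UpperBound

lemma card_le_ncard_closure {α : Type*} {M : Matroid α} {E X : Finset α}
    (hE : (E : Set α) = M.E) (hX : X ⊆ E) : X.card ≤ (M.closure X).ncard := by
  rw [← Set.ncard_coe_finset]
  refine Set.ncard_le_ncard (M.subset_closure _ ?_) (E.finite_toSet.subset ?_)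
  · rw [← hE]
    exact_mod_cast hX
  · rw [hE]
    exact M.closure_subset_ground _

variable {α : Type*} [DecidableEq α] {M : Matroid α} [M.RankFinite]

/-- The colours can be represented by a spanning set. The lower bounds on the number of colours
force a set `R` of representatives to have corank at most one. If the corank is one, exchange an
element of `R` for an element of the same colour outside the hyperplane spanned by `R`. -/
lemma exists_spanning_representatives {E : Finset α} (hE : (E : Set α) = M.E) (c : α → ℕ)
    (hout : ∀ F, M.IsFlat F → rk M F < rk M M.E → F.ncard < E.card)
    (hcol : ∀ F, M.IsFlat F → rk M F + 2 ≤ rk M M.E → F.ncard + 1 < (E.image c).card) :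
    ∃ R ⊆ E, Set.InjOn c R ∧ R.card = (E.image c).card ∧ rk M R = rk M M.E := by
  have hrank : ∀ X ⊆ E, (E.image c).card ≤ X.card + 1 → rk M M.E ≤ rk M X + 1 := by
    intro X hX hcard
    by_contra! h
    have h1 := hcol (M.closure X) (M.isFlat_closure _) (by rw [rk_closure]; omega)
    have h2 := card_le_ncard_closure hE hX
    omega
  obtain ⟨R, hRE, hRinj, hRim⟩ :=
    Finset.exists_subset_injOn_image_eq_of_surjOn (f := c) (E : Set α) (E.image c)
      (by rw [Finset.coe_image]; exact Set.surjOn_image c E)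
  rw [Finset.coe_subset] at hRE
  have hRcard : R.card = (E.image c).card := by rw [← hRim, Finset.card_image_of_injOn hRinj]
  by_cases hR : rk M M.E ≤ rk M R
  · exact ⟨R, hRE, hRinj, hRcard, le_antisymm (rk_le_rk_ground _) hR⟩
  obtain ⟨e, heE, heR⟩ : ∃ e ∈ E, e ∉ M.closure R := by
    by_contra! h
    have h1 := hout (M.closure R) (M.isFlat_closure _) (by rw [rk_closure]; omega)
    have h2 : (E : Set α) ⊆ M.closure R := h
    have h3 := Set.ncard_le_ncard h2
      (E.finite_toSet.subset (hE ▸ M.closure_subset_ground _))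
    rw [Set.ncard_coe_finset] at h3
    omega
  obtain ⟨f, hfR, hfe⟩ : ∃ f ∈ R, c f = c e := by
    have : c e ∈ R.image c := hRim ▸ Finset.mem_image_of_mem c heE
    simpa using this
  have heR' : e ∉ R := fun h =>
    heR (M.subset_closure R (by rw [← hE]; exact_mod_cast hRE) h)
  have hsub : R.erase f ⊆ E := (Finset.erase_subset _ _).trans hRE
  have hcard := Finset.card_erase_add_one hfR
  refine ⟨insert e (R.erase f), Finset.insert_subset heE hsub, ?_, ?_, ?_⟩
  · have hne : ∀ x ∈ R.erase f, c x ≠ c e := fun x hx h =>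
      (Finset.mem_erase.1 hx).1 (hRinj (Finset.mem_erase.1 hx).2 hfR (h.trans hfe.symm))
    intro x hx y hy hxy
    rw [Finset.mem_coe, Finset.mem_insert] at hx hy
    rcases hx with rfl | hx <;> rcases hy with rfl | hy
    · rfl
    · exact absurd hxy.symm (hne y hy)
    · exact absurd hxy (hne x hx)
    · exact hRinj (Finset.mem_erase.1 hx).2 (Finset.mem_erase.1 hy).2 hxy
  · rw [Finset.card_insert_of_notMem fun h => heR' (Finset.mem_erase.1 h).2]
    omega
  · have h1 := hrank (R.erase f) hsub (by omega)
    have h2 : e ∉ M.closure (R.erase f) := fun h =>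
      heR (M.closure_subset_closure (by exact_mod_cast Finset.erase_subset f R) h)
    have h3 := rk_insert_of_notMem_closure (hE ▸ Finset.mem_coe.2 heE) h2
    refine le_antisymm (rk_le_rk_ground _) ?_
    push_cast at h3 h1 ⊢
    omega

/-- A colouring with more colours than the formula allows has `t` disjoint rainbow bases, provided
that the packing condition for `t` disjoint bases holds. A spanning set `R` of representatives
contains a set of more than `t * (r - 1)` elements that is sparse for `t * rk`. It extends to a
sparse set of `t * r` elements, which misses fewer than `t` from being rainbow. -/
theorem hasDisjointRainbowBases_of_lt [M.Finite] {t : ℕ} (ht : 1 ≤ t) (hr : 2 ≤ rk M M.E)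
    (c : α → ℕ)
    (hpack : ∀ F, M.IsFlat F → F.ncard + t * rk M M.E ≤ M.E.ncard + t * rk M F)
    (hcol : ∀ F, M.IsFlat F → rk M F + 2 ≤ rk M M.E →
      F.ncard + t * rk M M.E < (c '' M.E).ncard + t * rk M F + t) :
    HasDisjointRainbowBases M c t := by
  obtain ⟨E, hE⟩ := M.ground_finite.exists_finset_coe
  rw [← hE, ← Finset.coe_image, Set.ncard_coe_finset, hE] at hcol
  rw [← hE, Set.ncard_coe_finset, hE] at hpack
  have hmul : ∀ {a b : ℕ}, a ≤ b → t * a ≤ t * b := fun h => Nat.mul_le_mul_left t h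
  obtain ⟨R, hRE, hRinj, hRcard, hRrk⟩ := exists_spanning_representatives hE c
    (fun F hF h => by
      have h1 := hpack F hF
      have h2 := hmul (Nat.succ_le_of_lt h)
      rw [Nat.mul_succ] at h2
      omega)
    (fun F hF h => by
      have h1 := hcol F hF h
      have h2 := hmul h
      rw [mul_add] at h2
      omega)
  have hf : IsPolymatroidRank fun X : Finset α => t * rk M X := by
    have hρ := isPolymatroidRank_rk (M := M)
    refine ⟨by simp [rk], fun X Y h => hmul (hρ.mono h), fun X Y => ?_⟩
    have := hmul (hρ.submod X Y)
    rwa [mul_add, mul_add] at this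
  have hcover : ∀ V, ∀ Z ⊆ E, V.card ≤ (V \ Z).card + (M.closure Z).ncard := by
    intro V Z hZ
    have h1 := Finset.card_le_card_sdiff_add_card (s := V) (t := Z)
    have h2 := card_le_ncard_closure hE hZ
    omega
  obtain ⟨U, -, hUR, hU, Z, hZR, hZ⟩ := hf.exists_sparse_superset (Finset.empty_subset R)
    (fun X hX => by simp [Finset.subset_empty.1 hX])
  have hUcard : t * rk M M.E < U.card + t := by
    rcases lt_trichotomy (rk M Z + 1) (rk M M.E) with h | h | h
    · have h1 := hcol (M.closure Z) (M.isFlat_closure _) (by rw [rk_closure]; omega)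
      rw [rk_closure] at h1
      have h2 := hcover R Z (hZR.trans hRE)
      omega
    · have h1 : (R \ Z).Nonempty := by
        rw [Finset.nonempty_iff_ne_empty, Ne, Finset.sdiff_eq_empty_iff_subset]
        intro h1
        have h2 : rk M R ≤ rk M Z := rk_mono (by exact_mod_cast h1)
        omega
      have h2 := h1.card_pos
      rw [← h, mul_add_one]
      omega
    · have h1 := hmul (Nat.le_of_lt_succ h)
      omega
  obtain ⟨J, hUJ, hJE, hJ, Z', hZE, hZ'⟩ := hf.exists_sparse_superset (hUR.trans hRE) hU
  have hJE' : (J : Set α) ⊆ M.E := by rw [← hE]; exact_mod_cast hJE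
  have hJcard : J.card = t * rk M M.E := by
    refine le_antisymm ((hJ J subset_rfl).trans (hmul (rk_le_rk_ground _))) ?_
    have h1 := hpack (M.closure Z') (M.isFlat_closure _)
    rw [rk_closure] at h1
    have h2 := hcover E Z' hZE
    omega
  have hJcol : U.card ≤ (J.image c).card := by
    rw [← Finset.card_image_of_injOn (hRinj.mono (by exact_mod_cast hUR))]
    exact Finset.card_le_card (Finset.image_subset_image hUJ)
  obtain ⟨B, hB, -, hBd⟩ :=
    exists_rainbow_bases_of_sparse c (by omega) t J hJE' hJ hJcard (by omega)
  exact ⟨fun i => B i, hB, fun i j hij => Finset.disjoint_coe.2 (hBd i j hij)⟩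

end UpperBound

/-! ### Extremal colourings -/

section LowerBound

variable {α : Type*} {M : Matroid α}

lemma mul_le_card_of_disjoint [DecidableEq α] {t n : ℕ} {B : Fin t → Finset α} {Q : Finset α}
    (hB : ∀ i j, i ≠ j → Disjoint (B i) (B j)) (hn : ∀ i, n ≤ (B i ∩ Q).card) :
    t * n ≤ Q.card := by
  have h1 : (Finset.univ.biUnion fun i => B i ∩ Q).card = ∑ i, (B i ∩ Q).card :=
    Finset.card_biUnion fun i _ j _ hij =>
      (hB i j hij).mono Finset.inter_subset_left Finset.inter_subset_left
  have h2 := Finset.card_le_card (Finset.biUnion_subset.2 fun i (_ : i ∈ Finset.univ) =>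
    (Finset.inter_subset_right : B i ∩ Q ⊆ Q))
  have h3 := Finset.card_nsmul_le_sum Finset.univ (fun i => (B i ∩ Q).card) n fun i _ => hn i
  rw [Finset.card_univ, Fintype.card_fin, smul_eq_mul] at h3
  omega

lemma HasDisjointRainbowBases.exists_finset [M.Finite] {c : α → ℕ} {t : ℕ}
    (h : HasDisjointRainbowBases M c t) :
    ∃ B : Fin t → Finset α, (∀ i, M.IsBase (B i) ∧ Set.InjOn c (B i)) ∧
      ∀ i j, i ≠ j → Disjoint (B i) (B j) := by
  obtain ⟨B, hB, hd⟩ := h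
  have hfin : ∀ i, ∃ b : Finset α, (b : Set α) = B i := fun i =>
    (M.ground_finite.subset (hB i).1.subset_ground).exists_finset_coe
  choose b hb using hfin
  refine ⟨b, fun i => ?_, fun i j hij => ?_⟩
  · rw [hb]
    exact hB i
  · rw [← Finset.disjoint_coe, hb, hb]
    exact hd i j hij

lemma rk_ground_le_rk_add_card_sdiff [DecidableEq α] [M.RankFinite] {B F : Finset α}
    (hB : M.IsBase B) : rk M M.E ≤ rk M F + (B \ F).card := by
  have h1 := card_eq_of_isBase hB
  have h2 : (B ∩ F).card ≤ rk M F :=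
    card_le_rk_of_indep (hB.indep.subset (by simp)) (by simp)
  have h3 := Finset.card_sdiff_add_card_inter B F
  omega

/-- If too few elements lie outside `F` for `t` disjoint bases, the colouring with all colours
distinct has no `t` disjoint rainbow bases. -/
lemma ncard_ground_mem_colorCounts [M.Finite] {t : ℕ} {F : Set α} (hFE : F ⊆ M.E)
    (h : M.E.ncard + t * rk M F < F.ncard + t * rk M M.E) :
    M.E.ncard ∈ colorCounts M t := by
  classical
  obtain ⟨g, hg⟩ := Set.countable_iff_exists_injOn.1 M.ground_finite.countable
  refine ⟨g, hg.ncard_image, fun hcon => ?_⟩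
  obtain ⟨B, hB, hBd⟩ := hcon.exists_finset
  obtain ⟨E, hE⟩ := M.ground_finite.exists_finset_coe
  obtain ⟨F, rfl⟩ := (M.ground_finite.subset hFE).exists_finset_coe
  have hFE' : F ⊆ E := by rw [← Finset.coe_subset, hE]; exact hFE
  have h1 : t * (rk M M.E - rk M F) ≤ (E \ F).card := by
    refine mul_le_card_of_disjoint hBd fun i => ?_
    have h2 := rk_ground_le_rk_add_card_sdiff (F := F) (hB i).1
    have h3 : B i ⊆ E := by rw [← Finset.coe_subset, hE]; exact (hB i).1.subset_ground
    rw [← Finset.inter_sdiff_assoc, Finset.inter_eq_left.2 h3]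
    omega
  have h2 := Finset.card_sdiff_add_card_eq_card hFE'
  rw [Nat.mul_sub] at h1
  rw [Set.ncard_coe_finset, ← hE, Set.ncard_coe_finset, hE] at h
  omega

/-- The extremal colouring: the elements of `F` and `t * (r(E) - r(F) - 1) - 1` further elements
receive distinct colours, all others share one more colour. Each rainbow basis then contains at
least `r(E) - r(F) - 1` of the further elements. -/
lemma mem_colorCounts_of_flat [M.Finite] {t : ℕ} (ht : 1 ≤ t) {F : Set α} (hFE : F ⊆ M.E)
    (hF : rk M F + 2 ≤ rk M M.E) (hcard : F.ncard + t * rk M M.E ≤ M.E.ncard + t * rk M F) :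
    F.ncard + t * (rk M M.E - rk M F - 1) ∈ colorCounts M t := by
  classical
  obtain ⟨g, hg⟩ := Set.countable_iff_exists_injOn.1 M.ground_finite.countable
  obtain ⟨E, hE⟩ := M.ground_finite.exists_finset_coe
  obtain ⟨F, rfl⟩ := (M.ground_finite.subset hFE).exists_finset_coe
  have hFE' : F ⊆ E := by rw [← Finset.coe_subset, hE]; exact hFE
  rw [Set.ncard_coe_finset, ← hE, Set.ncard_coe_finset, hE] at hcard
  rw [Set.ncard_coe_finset]
  obtain ⟨n, hn⟩ : ∃ n, rk M M.E = rk M F + n + 2 := ⟨rk M M.E - (rk M F + 2), by omega⟩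
  have hn' : rk M M.E - rk M F - 1 = n + 1 := by omega
  rw [hn']
  have hsd := Finset.card_sdiff_add_card_eq_card hFE'
  have hexp : t * rk M M.E = t * rk M F + t * (n + 1) + t := by rw [hn]; ring
  have hpos : 1 ≤ t * (n + 1) := Nat.mul_pos ht n.succ_pos
  obtain ⟨Q, hQ, hQcard⟩ := Finset.exists_subset_card_eq (s := E \ F) (n := t * (n + 1) - 1)
    (by omega)
  have hQE : Q ⊆ E := hQ.trans Finset.sdiff_subset
  have hFQ : Disjoint F Q := Finset.disjoint_sdiff.mono_right hQ
  have hFQcard : (F ∪ Q).card = F.card + Q.card := Finset.card_union_of_disjoint hFQ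
  have hFQE : F ∪ Q ⊆ E := Finset.union_subset hFE' hQE
  let c : α → ℕ := fun x => if x ∈ F ∪ Q then g x + 1 else 0
  obtain ⟨z, hzE, hz⟩ : ∃ z ∈ E, z ∉ F ∪ Q := by
    refine Finset.exists_mem_notMem_of_card_lt_card ?_
    omega
  have him : E.image c = insert 0 ((F ∪ Q).image fun x => g x + 1) := by
    ext k
    simp only [Finset.mem_insert, Finset.mem_image, c]
    constructor
    · rintro ⟨x, hx, rfl⟩
      by_cases h : x ∈ F ∪ Q
      · exact Or.inr ⟨x, h, by rw [if_pos h]⟩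
      · exact Or.inl (if_neg h)
    · rintro (rfl | ⟨x, hx, rfl⟩)
      · exact ⟨z, hzE, if_neg hz⟩
      · exact ⟨x, hFQE hx, if_pos hx⟩
  refine ⟨c, ?_, fun hcon => ?_⟩
  · rw [← hE, ← Finset.coe_image, Set.ncard_coe_finset, him,
      Finset.card_insert_of_notMem (by simp), Finset.card_image_of_injOn, hFQcard, hQcard]
    · omega
    · intro x hx y hy hxy
      refine hg ?_ ?_ (Nat.succ_injective hxy) <;> rw [← hE]
      · exact hFQE hx
      · exact hFQE hy
  · obtain ⟨B, hB, hBd⟩ := hcon.exists_finset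
    have h1 : t * (n + 1) ≤ Q.card := by
      refine mul_le_card_of_disjoint hBd fun i => ?_
      have h2 := rk_ground_le_rk_add_card_sdiff (F := F) (hB i).1
      have h3 : (B i \ (F ∪ Q)).card ≤ 1 := by
        refine Finset.card_le_one.2 fun x hx y hy => ?_
        rw [Finset.mem_sdiff] at hx hy
        exact (hB i).2 hx.1 hy.1 (by simp only [c, if_neg hx.2, if_neg hy.2])
      have h4 : B i \ F ⊆ (B i ∩ Q) ∪ (B i \ (F ∪ Q)) := by
        intro x hx
        simp only [Finset.mem_sdiff, Finset.mem_union, Finset.mem_inter] at hx ⊢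
        tauto
      have h5 := (Finset.card_le_card h4).trans (Finset.card_union_le _ _)
      omega
    omega

end LowerBound

end AntiRamsey

/-! ### The formula -/

theorem mainTheorem1 {α : Type*} (M : Matroid α) [M.Finite] (t : ℕ) (ht : 1 ≤ t)
    (hr : 2 ≤ AntiRamsey.rk M M.E) :
    -- the maximum that defines `ar M t` is attained
    IsGreatest (AntiRamsey.colorCounts M t) (AntiRamsey.ar M t) ∧
    ((∃ F : Set α, M.IsFlat F ∧
        (M.E.ncard : ℤ) - (F.ncard : ℤ)
          < (t : ℤ) * ((AntiRamsey.rk M M.E : ℤ) - (AntiRamsey.rk M F : ℤ))) →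
      AntiRamsey.ar M t = M.E.ncard) ∧
    ((¬ ∃ F : Set α, M.IsFlat F ∧
        (M.E.ncard : ℤ) - (F.ncard : ℤ)
          < (t : ℤ) * ((AntiRamsey.rk M M.E : ℤ) - (AntiRamsey.rk M F : ℤ))) →
      IsGreatest
        {n : ℤ | ∃ F : Set α, M.IsFlat F ∧
          (AntiRamsey.rk M F : ℤ) ≤ (AntiRamsey.rk M M.E : ℤ) - 2 ∧
          n = (F.ncard : ℤ)
            + (t : ℤ) * ((AntiRamsey.rk M M.E : ℤ) - (AntiRamsey.rk M F : ℤ) - 1)}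
        (AntiRamsey.ar M t : ℤ)) := by
  classical
  have hbdd : ∀ m ∈ AntiRamsey.colorCounts M t, m ≤ M.E.ncard := by
    rintro m ⟨c, rfl, -⟩
    exact Set.ncard_image_le M.ground_finite
  have hne : (AntiRamsey.colorCounts M t).Nonempty := by
    refine ⟨_, fun _ => 0, rfl, fun hcon => ?_⟩
    obtain ⟨B, hB, -⟩ := hcon.exists_finset
    have h1 := AntiRamsey.card_eq_of_isBase (hB ⟨0, ht⟩).1
    have h2 : (B ⟨0, ht⟩).card ≤ 1 :=
      Finset.card_le_one.2 fun x hx y hy => (hB ⟨0, ht⟩).2 hx hy rfl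
    omega
  have hbdd' : BddAbove (AntiRamsey.colorCounts M t) := ⟨_, hbdd⟩
  have hmem : AntiRamsey.ar M t ∈ AntiRamsey.colorCounts M t := Nat.sSup_mem hne hbdd'
  have hle : ∀ m ∈ AntiRamsey.colorCounts M t, m ≤ AntiRamsey.ar M t := fun m hm =>
    le_csSup hbdd' hm
  refine ⟨⟨hmem, hle⟩, ?_, fun hno => ?_⟩
  · rintro ⟨F, hF, h⟩
    refine le_antisymm (hbdd _ hmem) (hle _ ?_)
    refine AntiRamsey.ncard_ground_mem_colorCounts hF.subset_ground (F := F) ?_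
    zify
    linarith
  · push Not at hno
    have hpack : ∀ F, M.IsFlat F →
        F.ncard + t * AntiRamsey.rk M M.E ≤ M.E.ncard + t * AntiRamsey.rk M F := by
      intro F hF
      have := hno F hF
      zify
      linarith
    have hlow : ∀ F, M.IsFlat F → AntiRamsey.rk M F + 2 ≤ AntiRamsey.rk M M.E →
        (F.ncard : ℤ) + t * ((AntiRamsey.rk M M.E : ℤ) - AntiRamsey.rk M F - 1) ≤
          AntiRamsey.ar M t := by
      intro F hF h
      have h1 := hle _ (AntiRamsey.mem_colorCounts_of_flat ht hF.subset_ground h (hpack F hF))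
      zify at h1
      rwa [Nat.sub_sub, Nat.cast_sub (by omega), Nat.cast_add, Nat.cast_one, ← sub_sub] at h1
    refine ⟨?_, ?_⟩
    · obtain ⟨c, hc, hcon⟩ := hmem
      obtain ⟨F, hF, h, hval⟩ : ∃ F, M.IsFlat F ∧
          AntiRamsey.rk M F + 2 ≤ AntiRamsey.rk M M.E ∧
          (c '' M.E).ncard + t * AntiRamsey.rk M F + t ≤
            F.ncard + t * AntiRamsey.rk M M.E := by
        by_contra! hall
        exact hcon (AntiRamsey.hasDisjointRainbowBases_of_lt ht hr c hpack hall)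
      refine ⟨F, hF, by omega, le_antisymm ?_ (hlow F hF h)⟩
      rw [hc] at hval
      zify at hval
      linarith
    · rintro n ⟨F, hF, h, rfl⟩
      exact hlow F hF (by omega)
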